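/- Let $M$ be a complex manifold of real dimension $2m$, i.e. a smooth manifold of real dimension $2m$ with a complex structure $J$: a smooth field of endomorphisms of the tangent spaces with $J^2=-1$ and vanishing Nijenhuis tensor $N_J(v,w)=[v,w]+J[v,Jw]+J[Jv,w]-[Jv,Jw]$. Let $g$ be a Kähler metric on $(M,J)$, i.e. a smooth Riemannian metric with $g(Jv,Jw)=g(v,w)$ for all $v,w$ whose Hermitian form $\omega(v,w)=g(Jv,w)$ is closed, $d\omega=0$. For $p\in M$ let $\mathrm{Hol}_p(M)$ be the holonomy group of $M$ at $p$: the set of all linear maps $P_c:T_pM\to T_pM$ given by parallel transport, with respect to the Levi-Civita connection of $g$, around piecewise $C^1$ loops $c$ based at $p$. Then the holonomy group of $M$ is contained in $U(m)$. That is, for every $p\in M$ there is a real-linear isomorphism $\Phi:T_pM\to\mathbb{C}^m$ that carries $J_p$ to multiplication by $i$ and the length given by $g_p$ to the standard Hermitian length of $\mathbb{C}^m$, such that for every $P\in\mathrm{Hol}_p(M)$ the map $\Phi P\Phi^{-1}$ is given by a unitary $m\times m$ matrix. -/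

import Mathlib

open Bundle Manifold ContDiff

noncomputable section

namespace KahlerHolonomy

open VectorField FiberBundle

/-! ### The Levi-Civita connection -/

section Riemannian

variable {E : Type*} [NormedAddCommGroup E] [NormedSpace ℝ E]
  {H : Type*} [TopologicalSpace H] {I : ModelWithCorners ℝ E H}
  {M : Type*} [TopologicalSpace M] [ChartedSpace H M]
  [RiemannianBundle (fun x : M ↦ TangentSpace I x)]

/-- The right-hand side of the Koszul formula,
`X⟨Y, Z⟩ + Y⟨X, Z⟩ - Z⟨X, Y⟩ + ⟨[X, Y], Z⟩ - ⟨[X, Z], Y⟩ - ⟨[Y, Z], X⟩`. -/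
def koszul (X Y Z : Π x : M, TangentSpace I x) (x : M) : ℝ :=
  mvfderiv I (fun y ↦ inner ℝ (Y y) (Z y)) x (X x)
    + mvfderiv I (fun y ↦ inner ℝ (X y) (Z y)) x (Y x)
    - mvfderiv I (fun y ↦ inner ℝ (X y) (Y y)) x (Z x)
    + inner ℝ (mlieBracket I X Y x) (Z x)
    - inner ℝ (mlieBracket I X Z x) (Y x)
    - inner ℝ (mlieBracket I Y Z x) (X x)

variable [FiniteDimensional ℝ E] [CompleteSpace E] [IsManifold I ∞ M]
  [IsContMDiffRiemannianBundle I ∞ E (fun x : M ↦ TangentSpace I x)]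

set_option linter.unusedSectionVars false in
lemma mdiffAt_inner {X Y : Π x : M, TangentSpace I x} {x : M}
    (hX : MDiffAt (T% X) x) (hY : MDiffAt (T% Y) x) :
    MDiffAt (fun y ↦ inner ℝ (X y) (Y y)) x :=
  MDifferentiableAt.inner_bundle (F := E) (E := fun x : M ↦ TangentSpace I x) (b := fun x ↦ x) hX hY

/-- The Koszul expression is tensorial in its first argument. -/
lemma koszul_tensorialAt_left {Y Z : Π x : M, TangentSpace I x} {x : M}
    (hY : MDiffAt (T% Y) x) (hZ : MDiffAt (T% Z) x) :
    TensorialAt I E (fun X ↦ koszul X Y Z x) x where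
  smul {f X} hf hX := by
    simp [koszul, mlieBracket_smul_left hf hX, inner_add_left, inner_smul_left, inner_smul_right,
      mvfderiv_fun_mul hf (mdiffAt_inner hX hZ), mvfderiv_fun_mul hf (mdiffAt_inner hX hY)]
    rw [real_inner_comm (Z x) (X x), real_inner_comm (Y x) (X x)]
    ring
  add {X X'} hX hX' := by
    simp [koszul, mlieBracket_add_left hX hX', inner_add_left, inner_add_right,
      mvfderiv_fun_add (mdiffAt_inner hX hZ) (mdiffAt_inner hX' hZ),
      mvfderiv_fun_add (mdiffAt_inner hX hY) (mdiffAt_inner hX' hY)]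
    ring

/-- The Koszul expression is tensorial in its third argument. -/
lemma koszul_tensorialAt_right {X Y : Π x : M, TangentSpace I x} {x : M}
    (hX : MDiffAt (T% X) x) (hY : MDiffAt (T% Y) x) :
    TensorialAt I E (fun Z ↦ koszul X Y Z x) x where
  smul {f Z} hf hZ := by
    simp [koszul, mlieBracket_smul_right hf hZ, inner_add_left, inner_smul_left, inner_smul_right,
      mvfderiv_fun_mul hf (mdiffAt_inner hX hZ), mvfderiv_fun_mul hf (mdiffAt_inner hY hZ)]
    rw [real_inner_comm (Z x) (X x), real_inner_comm (Z x) (Y x)]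
    ring
  add {Z Z'} hZ hZ' := by
    simp [koszul, mlieBracket_add_right hZ hZ', inner_add_left, inner_add_right,
      mvfderiv_fun_add (mdiffAt_inner hX hZ) (mdiffAt_inner hX hZ'),
      mvfderiv_fun_add (mdiffAt_inner hY hZ) (mdiffAt_inner hY hZ')]
    ring

open Classical in
/-- `∇_v Y` at `x` is the vector determined by `2 ⟨∇_v Y, Z⟩ = koszul v Y Z` for all `Z`, if the
vector field `Y` is differentiable at `x` (and `0` otherwise). -/
def leviCivitaAux (Y : Π x : M, TangentSpace I x) (x : M) :
    TangentSpace I x →L[ℝ] TangentSpace I x :=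
  if hY : MDiffAt (T% Y) x then
    haveI : FiniteDimensional ℝ (TangentSpace I x) := inferInstanceAs (FiniteDimensional ℝ E)
    haveI : CompleteSpace (TangentSpace I x) := FiniteDimensional.complete ℝ _
    LinearMap.toContinuousLinearMap
      { toFun := fun v ↦ (1 / 2 : ℝ) • (InnerProductSpace.toDual ℝ (TangentSpace I x)).symm
          (TensorialAt.mkHom₂ (fun X Z ↦ koszul X Y Z x) x
            (fun _ hZ ↦ koszul_tensorialAt_left hY hZ)
            (fun _ hX ↦ koszul_tensorialAt_right hX hY) v)
        map_add' := fun v w ↦ by simp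
        map_smul' := fun a v ↦ by simp [smul_comm a] }
  else 0

lemma inner_leviCivitaAux {X Y Z : Π x : M, TangentSpace I x} {x : M}
    (hX : MDiffAt (T% X) x) (hY : MDiffAt (T% Y) x) (hZ : MDiffAt (T% Z) x) :
    inner ℝ (leviCivitaAux Y x (X x)) (Z x) = (1 / 2 : ℝ) * koszul X Y Z x := by
  have : FiniteDimensional ℝ (TangentSpace I x) := inferInstanceAs (FiniteDimensional ℝ E)
  have : CompleteSpace (TangentSpace I x) := FiniteDimensional.complete ℝ _
  have key := TensorialAt.mkHom₂_apply (Φ := fun X Z ↦ koszul X Y Z x) (x := x)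
            (fun _ hZ ↦ koszul_tensorialAt_left hY hZ)
            (fun _ hX ↦ koszul_tensorialAt_right hX hY) hX hZ
  simp only [leviCivitaAux, dif_pos hY]
  rw [← key]
  simp [inner_smul_left]

set_option linter.unusedSectionVars false in
lemma ext_inner {x : M} {v w : TangentSpace I x}
    (h : ∀ Z : Π x : M, TangentSpace I x, MDiffAt (T% Z) x → inner ℝ v (Z x) = inner ℝ w (Z x)) :
    v = w := by
  refine ext_inner_right ℝ fun z ↦ ?_
  simpa using h (extend E z) (mdifferentiableAt_extend I E z)

lemma koszul_add_middle {X Y Y' Z : Π x : M, TangentSpace I x} {x : M} (hX : MDiffAt (T% X) x)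
    (hY : MDiffAt (T% Y) x) (hY' : MDiffAt (T% Y') x) (hZ : MDiffAt (T% Z) x) :
    koszul X (Y + Y') Z x = koszul X Y Z x + koszul X Y' Z x := by
  simp [koszul, mlieBracket_add_left hY hY', mlieBracket_add_right hY hY',
    inner_add_left, inner_add_right,
    mvfderiv_fun_add (mdiffAt_inner hY hZ) (mdiffAt_inner hY' hZ),
    mvfderiv_fun_add (mdiffAt_inner hX hY) (mdiffAt_inner hX hY')]
  ring

lemma koszul_smul_middle {X Y Z : Π x : M, TangentSpace I x} {f : M → ℝ} {x : M}
    (hX : MDiffAt (T% X) x) (hY : MDiffAt (T% Y) x) (hf : MDiffAt f x) (hZ : MDiffAt (T% Z) x) :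
    koszul X (f • Y) Z x
      = f x * koszul X Y Z x + 2 * (mvfderiv I f x (X x) * inner ℝ (Y x) (Z x)) := by
  simp [koszul, mlieBracket_smul_left hf hY, mlieBracket_smul_right hf hY, inner_add_left,
    inner_smul_left, inner_smul_right, mvfderiv_fun_mul hf (mdiffAt_inner hY hZ),
    mvfderiv_fun_mul hf (mdiffAt_inner hX hY)]
  rw [real_inner_comm (X x) (Y x)]
  ring

variable (I M) in
/-- The Levi-Civita connection of a Riemannian manifold, defined by the Koszul formula. It is the
torsion-free metric connection, see `leviCivita_torsion` and `leviCivita_isMetricCompatible`. -/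
def leviCivita : CovariantDerivative I E (fun x : M ↦ TangentSpace I x) where
  toFun := leviCivitaAux
  isCovariantDerivativeOnUniv :=
    { add := fun {Y Y' x} hY hY' _ ↦ by
        ext v
        obtain ⟨X, hX, rfl⟩ : ∃ X : Π x : M, TangentSpace I x, MDiffAt (T% X) x ∧ X x = v :=
          ⟨extend E v, mdifferentiableAt_extend I E v, by simp⟩
        refine ext_inner fun Z hZ ↦ ?_
        rw [add_apply, inner_add_left, inner_leviCivitaAux hX hY hZ,
          inner_leviCivitaAux hX hY' hZ,
          inner_leviCivitaAux hX (mdifferentiableAt_add_section hY hY') hZ,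
          koszul_add_middle hX hY hY' hZ, mul_add]
      leibniz := fun {Y f x} hY hf _ ↦ by
        ext v
        obtain ⟨X, hX, rfl⟩ : ∃ X : Π x : M, TangentSpace I x, MDiffAt (T% X) x ∧ X x = v :=
          ⟨extend E v, mdifferentiableAt_extend I E v, by simp⟩
        refine ext_inner fun Z hZ ↦ ?_
        rw [inner_leviCivitaAux hX (hf.smul_section hY) hZ, koszul_smul_middle hX hY hf hZ,
          add_apply, inner_add_left, smul_apply,
          inner_smul_left, inner_leviCivitaAux hX hY hZ, ContinuousLinearMap.smulRight_apply,
          inner_smul_left]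
        simp
        ring }

theorem leviCivita_torsion : (leviCivita I M).torsion = 0 := by
  rw [CovariantDerivative.torsion_eq_zero_iff]
  intro X Y x hX hY
  refine ext_inner fun Z hZ ↦ ?_
  change inner ℝ (leviCivitaAux Y x (X x) - leviCivitaAux X x (Y x)) (Z x) = _
  rw [inner_sub_left, inner_leviCivitaAux hX hY hZ, inner_leviCivitaAux hY hX hZ]
  simp only [koszul, mlieBracket_swap_apply (V := Y) (W := X), real_inner_comm, inner_neg_left]
  ring

theorem leviCivita_metric {X Y Z : Π x : M, TangentSpace I x} {x : M} (hX : MDiffAt (T% X) x)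
    (hY : MDiffAt (T% Y) x) (hZ : MDiffAt (T% Z) x) :
    mvfderiv I (fun y ↦ inner ℝ (Y y) (Z y)) x (X x)
      = inner ℝ (leviCivita I M Y x (X x)) (Z x) + inner ℝ (Y x) (leviCivita I M Z x (X x)) := by
  change _ = inner ℝ (leviCivitaAux Y x (X x)) (Z x) + inner ℝ (Y x) (leviCivitaAux Z x (X x))
  rw [← real_inner_comm (Y x), inner_leviCivitaAux hX hY hZ, inner_leviCivitaAux hX hZ hY]
  simp only [koszul, mlieBracket_swap_apply (V := Z) (W := Y), inner_neg_left]
  have : (fun y ↦ inner ℝ (Z y) (Y y)) = fun y ↦ inner ℝ (Y y) (Z y) := by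
    funext y; exact real_inner_comm _ _
  rw [this]
  ring

theorem leviCivita_isMetricCompatible :
    CovariantDerivative.IsMetricCompatible (V := fun x : M ↦ TangentSpace I x)
      (leviCivita I M) := by
  rw [CovariantDerivative.isMetricCompatible_iff]
  intro x X Y Z hX hY hZ
  exact leviCivita_metric hX hY hZ

end Riemannian
/-! ### Parallel transport and holonomy of an affine connection -/

section Holonomy

variable {E : Type*} [NormedAddCommGroup E] [NormedSpace ℝ E]
  {H : Type*} [TopologicalSpace H] {I : ModelWithCorners ℝ E H}
  {M : Type*} [TopologicalSpace M] [ChartedSpace H M] [IsManifold I ∞ M]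

/-- The vector field `V` along the curve `c` has covariant derivative `W` at time `t` (within the
time interval `s`): `D V / dt = W`.

Let `e_i` be the coordinate frame of the tangent bundle in the chart at `c t`, and
`V = ∑ V^i e_i` near `t`. Then `D V / dt = ∑ (V^i)' e_i + ∑ V^i ∇_{c'} e_i` at `t`, and
`∑ V^i(t) e_i` is the extension `FiberBundle.extend E (V t)` of `V t` by a vector field that has
constant coordinates near `c t`. So the coordinate vector of `V` at times `τ` near `t` has to have
the derivative `W - ∇_{c'} (extend E (V t))`, read in the same frame. -/
def HasCovDerivAlong (cov : CovariantDerivative I E (fun x : M ↦ TangentSpace I x))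
    (c : ℝ → M) (V : Π t, TangentSpace I (c t)) (s : Set ℝ) (t : ℝ)
    (W : TangentSpace I (c t)) : Prop :=
  HasDerivWithinAt
    (fun τ ↦ (trivializationAt E (TangentSpace I) (c t) (⟨c τ, V τ⟩ : TangentBundle I M)).2)
    (trivializationAt E (TangentSpace I) (c t)
      (⟨c t, W - cov (extend E (V t)) (c t) (mfderivWithin 𝓘(ℝ, ℝ) I c s t (1 : ℝ))⟩ :
        TangentBundle I M)).2 s t

/-- `0 = t 0 < t 1 < ⋯ < t n = 1` is a subdivision of `[0, 1]` on each closed interval of which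
the curve `c` is of class `C^1`. -/
structure IsC1Subdivision (I : ModelWithCorners ℝ E H) (c : ℝ → M) (n : ℕ) (t : ℕ → ℝ) :
    Prop where
  zero : t 0 = 0
  last : t n = 1
  lt : ∀ i < n, t i < t (i + 1)
  contMDiffOn : ∀ i < n, ContMDiffOn 𝓘(ℝ, ℝ) I 1 c (Set.Icc (t i) (t (i + 1)))

/-- The vector field `V` along the curve `c : [0, 1] → M`, which is of class `C^1` on the
intervals `[t i, t (i + 1)]` of a subdivision, is parallel: its covariant derivative vanishes on
each of these intervals (at their end points: the one-sided covariant derivative). -/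
def IsParallelAlong (cov : CovariantDerivative I E (fun x : M ↦ TangentSpace I x))
    (c : ℝ → M) (n : ℕ) (t : ℕ → ℝ) (V : Π τ, TangentSpace I (c τ)) : Prop :=
  ∀ i < n, ∀ τ ∈ Set.Icc (t i) (t (i + 1)),
    HasCovDerivAlong cov c V (Set.Icc (t i) (t (i + 1))) τ 0

/-- `P : T_p M → T_p M` is the parallel transport around the piecewise `C^1` loop
`c : [0, 1] → M` at `p`: for every `X ∈ T_p M` there is a parallel vector field along `c` that
starts at `X` and ends at `P X`. -/
def IsLoopTransport (cov : CovariantDerivative I E (fun x : M ↦ TangentSpace I x))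
    (p : M) (c : ℝ → M) (P : TangentSpace I p →ₗ[ℝ] TangentSpace I p) : Prop :=
  c 0 = p ∧ c 1 = p ∧ ∃ (n : ℕ) (t : ℕ → ℝ), IsC1Subdivision I c n t ∧
    ∀ X : TangentSpace I p, ∃ V : Π τ, TangentSpace I (c τ), IsParallelAlong cov c n t V ∧
      (⟨c 0, V 0⟩ : TangentBundle I M) = ⟨p, X⟩ ∧ (⟨c 1, V 1⟩ : TangentBundle I M) = ⟨p, P X⟩

/-- The holonomy group `Hol_p` of an affine connection at `p`: the set of all the linear
transformations of `T_p M` given by parallel transport around piecewise `C^1` loops at `p`. -/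
def holonomyGroup (cov : CovariantDerivative I E (fun x : M ↦ TangentSpace I x)) (p : M) :
    Set (TangentSpace I p →ₗ[ℝ] TangentSpace I p) :=
  {P | ∃ c : ℝ → M, IsLoopTransport cov p c P}

end Holonomy

/-! ### Complex structures and Kähler metrics -/

section Kahler

variable {E : Type*} [NormedAddCommGroup E] [NormedSpace ℝ E]
  {H : Type*} [TopologicalSpace H] {I : ModelWithCorners ℝ E H}
  {M : Type*} [TopologicalSpace M] [ChartedSpace H M]

/-- The Nijenhuis tensor `N_J(V, W) = [V, W] + J[V, JW] + J[JV, W] - [JV, JW]`. -/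
def nijenhuis (J : Π x : M, TangentSpace I x →L[ℝ] TangentSpace I x)
    (V W : Π x : M, TangentSpace I x) (x : M) : TangentSpace I x :=
  mlieBracket I V W x
    + J x (mlieBracket I V (fun y ↦ J y (W y)) x)
    + J x (mlieBracket I (fun y ↦ J y (V y)) W x)
    - mlieBracket I (fun y ↦ J y (V y)) (fun y ↦ J y (W y)) x

/-- `J` is a complex structure on the smooth manifold `M`: a smooth field of endomorphisms of the
tangent spaces with `J² = -1`, whose Nijenhuis tensor vanishes (on all vector fields that are
smooth near the point). -/
structure IsComplexStructure [IsManifold I ∞ M]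
    (J : Π x : M, TangentSpace I x →L[ℝ] TangentSpace I x) : Prop where
  contMDiff : ContMDiff I (I.prod 𝓘(ℝ, E →L[ℝ] E)) ∞
    (fun x ↦ TotalSpace.mk' (E →L[ℝ] E)
      (E := fun x : M ↦ TangentSpace I x →L[ℝ] TangentSpace I x) x (J x))
  sq : ∀ (x : M) (v : TangentSpace I x), J x (J x v) = -v
  nijenhuis_eq_zero : ∀ (x : M) (V W : Π x : M, TangentSpace I x),
    ContMDiffAt I I.tangent ∞ (fun y ↦ (⟨y, V y⟩ : TangentBundle I M)) x →
    ContMDiffAt I I.tangent ∞ (fun y ↦ (⟨y, W y⟩ : TangentBundle I M)) x →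
    nijenhuis J V W x = 0

/-- The exterior derivative of a two-form `η`, evaluated at vector fields:
`dη(X, Y, Z) = X η(Y, Z) - Y η(X, Z) + Z η(X, Y) - η([X, Y], Z) + η([X, Z], Y) - η([Y, Z], X)`. -/
def extDerivTwoForm (η : Π x : M, TangentSpace I x → TangentSpace I x → ℝ)
    (X Y Z : Π x : M, TangentSpace I x) (x : M) : ℝ :=
  mvfderiv I (fun y ↦ η y (Y y) (Z y)) x (X x)
    - mvfderiv I (fun y ↦ η y (X y) (Z y)) x (Y x)
    + mvfderiv I (fun y ↦ η y (X y) (Y y)) x (Z x)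
    - η x (mlieBracket I X Y x) (Z x)
    + η x (mlieBracket I X Z x) (Y x)
    - η x (mlieBracket I Y Z x) (X x)

/-- The two-form `η` is closed: `dη = 0`. -/
def IsClosedTwoForm [IsManifold I ∞ M]
    (η : Π x : M, TangentSpace I x → TangentSpace I x → ℝ) : Prop :=
  ∀ (x : M) (X Y Z : Π x : M, TangentSpace I x),
    ContMDiffAt I I.tangent ∞ (fun y ↦ (⟨y, X y⟩ : TangentBundle I M)) x →
    ContMDiffAt I I.tangent ∞ (fun y ↦ (⟨y, Y y⟩ : TangentBundle I M)) x →
    ContMDiffAt I I.tangent ∞ (fun y ↦ (⟨y, Z y⟩ : TangentBundle I M)) x →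
    extDerivTwoForm η X Y Z x = 0

variable [RiemannianBundle (fun x : M ↦ TangentSpace I x)]

/-- The Hermitian form `ω(v, w) = g(Jv, w)`. -/
def hermitianForm (J : Π x : M, TangentSpace I x →L[ℝ] TangentSpace I x)
    (x : M) (v w : TangentSpace I x) : ℝ :=
  inner ℝ (J x v) w

/-- The Riemannian metric `g` of `M` is a Kähler metric for the complex structure `J`: it is
Hermitian, `g(Jv, Jw) = g(v, w)`, and its Hermitian form is closed. -/
structure IsKahlerMetric [IsManifold I ∞ M]
    (J : Π x : M, TangentSpace I x →L[ℝ] TangentSpace I x) : Prop where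
  hermitian : ∀ (x : M) (v w : TangentSpace I x), inner ℝ (J x v) (J x w) = inner ℝ v w
  closed : IsClosedTwoForm (hermitianForm J)

/-- A unitary frame of `T_p M`: a linear isomorphism with `ℂ^m` that carries `J` to
multiplication by `i` and the metric of `T_p M` to the standard metric of `ℂ^m`. -/
structure IsUnitaryFrame {m : ℕ} (J : Π x : M, TangentSpace I x →L[ℝ] TangentSpace I x) (p : M)
    (Φ : TangentSpace I p ≃ₗ[ℝ] EuclideanSpace ℂ (Fin m)) : Prop where
  map_J : ∀ v, Φ (J p v) = Complex.I • Φ v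
  norm_map : ∀ v, ‖Φ v‖ = ‖v‖

/-- The group `U(m)`, acting on `T_p M` through `Φ : T_p M ≃ ℂ^m`: the transformations of `T_p M`
which are given by a unitary matrix in the coordinates `Φ`. -/
def unitaryGroupIn {m : ℕ} {p : M} (Φ : TangentSpace I p ≃ₗ[ℝ] EuclideanSpace ℂ (Fin m)) :
    Set (TangentSpace I p →ₗ[ℝ] TangentSpace I p) :=
  {P | ∃ A ∈ Matrix.unitaryGroup (Fin m) ℂ, ∀ v, Φ (P v) = Matrix.toEuclideanLin A (Φ v)}

end Kahler

end KahlerHolonomy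

end

/-!
On a Kähler manifold the metric `g` and the Hermitian form `ω(v, w) = g(Jv, w)` are both parallel for
the Levi-Civita connection. For `g` this is metric compatibility. For `ω` it amounts to `∇J = 0`
(`leviCivita_map`), which follows from the identity
`2 g((∇_X J) Y, Z) = dω(X, Y, Z) - dω(X, JY, JZ) - g(N_J(Y, Z), JX)`, obtained by expanding
the left-hand side with the Koszul formula (`koszul_map_add_koszul_map`).

If `V` and `W` are parallel vector fields along a curve and `B` is a parallel form, then `B(V, W)` is
constant by the Leibniz rule along the curve (`IsParallelForm.hasDerivWithinAt`). Hence a holonomy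
transformation `P` preserves every parallel form (`IsParallelForm.apply_holonomy`), in particular `g`
and `ω`. So `P` is an isometry; being surjective, it also commutes with `J`, since
`g(P J v, P w) = g(J v, w) = g(J P v, P w)`.

Finally `T_p M` with `J` and the Hermitian inner product `g + iω` is isometric to `ℂ^m`
(`exists_unitary_equiv`), and in such coordinates the isometries commuting with `J` are the unitary
matrices (`IsUnitaryFrame.mem_unitaryGroupIn`).
-/

namespace KahlerHolonomy

open VectorField FiberBundle

/-! ### The complex structure of a Kähler manifold is parallel -/

section ParallelComplexStructure

variable {E : Type*} [NormedAddCommGroup E] [NormedSpace ℝ E]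
  {H : Type*} [TopologicalSpace H] {I : ModelWithCorners ℝ E H}
  {M : Type*} [TopologicalSpace M] [ChartedSpace H M] [IsManifold I ∞ M]
  {J : Π x : M, TangentSpace I x →L[ℝ] TangentSpace I x}

lemma IsComplexStructure.contMDiffAt_apply (hJ : IsComplexStructure J)
    {X : Π x : M, TangentSpace I x} {x : M} (hX : CMDiffAt ∞ (T% X) x) :
    CMDiffAt ∞ (T% (fun y ↦ J y (X y))) x :=
  ContMDiffAt.clm_bundle_apply (F₁ := E) (F₂ := E) (E₁ := fun x : M ↦ TangentSpace I x)
    (E₂ := fun x : M ↦ TangentSpace I x) (b := fun x ↦ x) (ϕ := J) (hJ.contMDiff x) hX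

variable [RiemannianBundle (fun x : M ↦ TangentSpace I x)]

lemma IsKahlerMetric.inner_map_left (hJ : IsComplexStructure J) (hg : IsKahlerMetric J) {x : M}
    (v w : TangentSpace I x) : inner ℝ (J x v) w = -inner ℝ v (J x w) := by
  rw [← hg.hermitian x v (J x w), hJ.sq, inner_neg_right, neg_neg]

/-- By the Koszul formula the left-hand side is `2 g((∇_X J) Y, Z)`. It vanishes because it equals
`dω(X, Y, Z) - dω(X, JY, JZ) - g(N_J(Y, Z), JX)`. -/
lemma koszul_map_add_koszul_map (hJ : IsComplexStructure J) (hg : IsKahlerMetric J)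
    {X Y Z : Π x : M, TangentSpace I x} {x : M} (hX : CMDiffAt ∞ (T% X) x)
    (hY : CMDiffAt ∞ (T% Y) x) (hZ : CMDiffAt ∞ (T% Z) x) :
    koszul X (fun y ↦ J y (Y y)) Z x + koszul X Y (fun y ↦ J y (Z y)) x = 0 := by
  have h₁ := hg.closed x X Y Z hX hY hZ
  have h₂ := hg.closed x X _ _ hX (hJ.contMDiffAt_apply hY) (hJ.contMDiffAt_apply hZ)
  have h₃ := congrArg (fun v ↦ (inner ℝ v (J x (X x)) : ℝ)) (hJ.nijenhuis_eq_zero x Y Z hY hZ)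
  have skew (y : M) (v w : TangentSpace I y) := hg.inner_map_left hJ v w
  have neg_deriv (f : M → ℝ) (v : TangentSpace I x) :
      mvfderiv I (fun y ↦ -f y) x v = -mvfderiv I f x v := by
    rw [mvfderiv_fun_neg]; rfl
  simp only [extDerivTwoForm, hermitianForm, nijenhuis, koszul, skew, hJ.sq, inner_neg_right,
    inner_neg_left, neg_deriv, inner_add_left, inner_sub_left, inner_zero_left, neg_neg] at h₁ h₂ h₃ ⊢
  linear_combination h₁ - h₂ - h₃

variable [FiniteDimensional ℝ E] [CompleteSpace E]
  [IsContMDiffRiemannianBundle I ∞ E (fun x : M ↦ TangentSpace I x)]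

/-- The complex structure of a Kähler manifold is parallel: `∇_v (JY) = J ∇_v Y`. -/
theorem leviCivita_map (hJ : IsComplexStructure J) (hg : IsKahlerMetric J)
    {Y : Π x : M, TangentSpace I x} {x : M} (hY : CMDiffAt ∞ (T% Y) x) (v : TangentSpace I x) :
    leviCivita I M (fun y ↦ J y (Y y)) x v = J x (leviCivita I M Y x v) := by
  have md {X : Π x : M, TangentSpace I x} (hX : CMDiffAt ∞ (T% X) x) : MDiffAt (T% X) x :=
    hX.mdifferentiableAt (by simp)
  refine ext_inner_right ℝ fun w ↦ ?_
  have hv := contMDiffAt_extend (k := ∞) I E v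
  have hw := contMDiffAt_extend (k := ∞) I E w
  have h₁ := inner_leviCivitaAux (md hv) (md (hJ.contMDiffAt_apply hY)) (md hw)
  have h₂ := inner_leviCivitaAux (md hv) (md hY) (md (hJ.contMDiffAt_apply hw))
  have h := koszul_map_add_koszul_map hJ hg hv hY hw
  simp only [extend_apply_self] at h₁ h₂
  rw [hg.inner_map_left hJ]
  change inner ℝ (leviCivitaAux _ x v) w = -inner ℝ (leviCivitaAux Y x v) _
  rw [h₁, h₂]
  linarith

end ParallelComplexStructure

/-! ### Parallel forms and holonomy -/

section ProductRule

variable {E : Type*} [NormedAddCommGroup E] [NormedSpace ℝ E] [FiniteDimensional ℝ E]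

/-- The product rule for a moving linear form evaluated at a moving vector, where the linear form
need only be differentiable pointwise. -/
lemma hasDerivWithinAt_linearMap_apply {ℓ : ℝ → E →ₗ[ℝ] ℝ} {u : ℝ → E} {ℓ' : ℝ} {u' : E}
    {s : Set ℝ} {t : ℝ} (hℓ : HasDerivWithinAt (fun τ ↦ ℓ τ (u t)) ℓ' s t)
    (hℓd : ∀ a, DifferentiableWithinAt ℝ (fun τ ↦ ℓ τ a) s t) (hu : HasDerivWithinAt u u' s t) :
    HasDerivWithinAt (fun τ ↦ ℓ τ (u τ)) (ℓ' + ℓ t u') s t := by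
  let b := Module.finBasis ℝ E
  have hcoord (i) : HasDerivWithinAt (fun τ ↦ b.repr (u τ - u t) i) (b.repr u' i) s t :=
    (LinearMap.toContinuousLinearMap (b.coord i)).hasFDerivAt.comp_hasDerivWithinAt t
      (hu.sub_const (u t))
  -- The coordinates of `u τ - u t` vanish at `t`, so the derivatives of the `ℓ τ (b i)` drop out.
  have hsum : HasDerivWithinAt (fun τ ↦ ∑ i, b.repr (u τ - u t) i * ℓ τ (b i)) (ℓ t u') s t := by
    have h := HasDerivWithinAt.fun_sum (u := Finset.univ)
      fun i _ ↦ (hcoord i).mul (hℓd (b i)).hasDerivWithinAt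
    refine h.congr_deriv ?_
    have hu' := congrArg (ℓ t) (b.sum_repr u')
    simp only [map_sum, map_smul, smul_eq_mul] at hu'
    simpa using hu'
  have hexp (τ : ℝ) : ℓ τ (u τ) = ℓ τ (u t) + ∑ i, b.repr (u τ - u t) i * ℓ τ (b i) := by
    have h := congrArg (ℓ τ) (b.sum_repr (u τ - u t))
    simp only [map_sum, map_smul, map_sub (ℓ τ), smul_eq_mul] at h
    linarith
  exact (hℓ.add hsum).congr_of_eventuallyEq (.of_forall hexp) (hexp t)

/-- The product rule for a moving bilinear form evaluated at two moving vectors, where the bilinear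
form need only be differentiable pointwise. -/
lemma hasDerivWithinAt_bilinear_apply {β : ℝ → E →ₗ[ℝ] E →ₗ[ℝ] ℝ} {v w : ℝ → E} {β' : ℝ} {v' w' : E}
    {s : Set ℝ} {t : ℝ} (hβ : HasDerivWithinAt (fun τ ↦ β τ (v t) (w t)) β' s t)
    (hβd : ∀ a b, DifferentiableWithinAt ℝ (fun τ ↦ β τ a b) s t)
    (hv : HasDerivWithinAt v v' s t) (hw : HasDerivWithinAt w w' s t) :
    HasDerivWithinAt (fun τ ↦ β τ (v τ) (w τ)) (β' + β t v' (w t) + β t (v t) w') s t :=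
  hasDerivWithinAt_linearMap_apply (ℓ := fun τ ↦ β τ (v τ))
    (hasDerivWithinAt_linearMap_apply (ℓ := fun τ ↦ (β τ).flip (w t)) hβ (fun a ↦ hβd a (w t)) hv)
    (fun b ↦ (hasDerivWithinAt_linearMap_apply (ℓ := fun τ ↦ (β τ).flip b)
      (hβd (v t) b).hasDerivWithinAt (fun a ↦ hβd a b) hv).differentiableWithinAt) hw

end ProductRule

section ParallelForm

/-- Equalities of points of the tangent bundle are used here in place of casts between the tangent
spaces at the equal base points `q` and `p`. -/
lemma form_congr {E : Type*} [NormedAddCommGroup E] [NormedSpace ℝ E]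
    {H : Type*} [TopologicalSpace H] {I : ModelWithCorners ℝ E H}
    {M : Type*} [TopologicalSpace M] [ChartedSpace H M]
    {B : Π x : M, TangentSpace I x →ₗ[ℝ] TangentSpace I x →ₗ[ℝ] ℝ} {p q : M}
    {v w : TangentSpace I q} {X Y : TangentSpace I p}
    (hv : (⟨q, v⟩ : TangentBundle I M) = ⟨p, X⟩) (hw : (⟨q, w⟩ : TangentBundle I M) = ⟨p, Y⟩) :
    B q v w = B p X Y := by
  cases hv
  cases hw
  rfl

variable {E : Type*} [NormedAddCommGroup E] [NormedSpace ℝ E]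
  {H : Type*} [TopologicalSpace H] {I : ModelWithCorners ℝ E H}
  {M : Type*} [TopologicalSpace M] [ChartedSpace H M] [IsManifold I ∞ M]

/-- The field `B` of bilinear forms on the tangent spaces is parallel:
`v (B(X, Y)) = B(∇_v X, Y) + B(X, ∇_v Y)` for smooth vector fields `X` and `Y`. -/
def IsParallelForm (cov : CovariantDerivative I E (fun x : M ↦ TangentSpace I x))
    (B : Π x : M, TangentSpace I x →ₗ[ℝ] TangentSpace I x →ₗ[ℝ] ℝ) : Prop :=
  ∀ (x : M) (X Y : Π x : M, TangentSpace I x), CMDiffAt ∞ (T% X) x → CMDiffAt ∞ (T% Y) x →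
    MDiffAt (fun y ↦ B y (X y) (Y y)) x ∧
    ∀ v : TangentSpace I x, mvfderiv I (fun y ↦ B y (X y) (Y y)) x v
      = B x (cov X x v) (Y x) + B x (X x) (cov Y x v)

variable {cov : CovariantDerivative I E (fun x : M ↦ TangentSpace I x)}
  {B : Π x : M, TangentSpace I x →ₗ[ℝ] TangentSpace I x →ₗ[ℝ] ℝ}
  {c : ℝ → M} {s : Set ℝ} {t : ℝ}

lemma IsParallelForm.hasDerivWithinAt_comp (hB : IsParallelForm cov B)
    (hc : MDifferentiableWithinAt 𝓘(ℝ, ℝ) I c s t) {X Y : Π x : M, TangentSpace I x}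
    (hX : CMDiffAt ∞ (T% X) (c t)) (hY : CMDiffAt ∞ (T% Y) (c t)) :
    HasDerivWithinAt (fun τ ↦ B (c τ) (X (c τ)) (Y (c τ)))
      (B (c t) (cov X (c t) (mfderivWithin 𝓘(ℝ, ℝ) I c s t (1 : ℝ))) (Y (c t))
        + B (c t) (X (c t)) (cov Y (c t) (mfderivWithin 𝓘(ℝ, ℝ) I c s t (1 : ℝ)))) s t := by
  obtain ⟨hd, h⟩ := hB (c t) X Y hX hY
  rw [← h]
  have h := hd.hasMFDerivAt.comp_hasMFDerivWithinAt t hc.hasMFDerivWithinAt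
  exact HasFDerivWithinAt.hasDerivWithinAt (𝕜 := ℝ) (F := ℝ) h.hasFDerivWithinAt

variable [FiniteDimensional ℝ E]

/-- A parallel form satisfies the Leibniz rule along curves,
`d/dt B(V, W) = B(DV/dt, W) + B(V, DW/dt)`. -/
theorem IsParallelForm.hasDerivWithinAt (hB : IsParallelForm cov B)
    (hc : MDifferentiableWithinAt 𝓘(ℝ, ℝ) I c s t) (ht : t ∈ s)
    {V W : Π τ, TangentSpace I (c τ)} {V' W' : TangentSpace I (c t)}
    (hV : HasCovDerivAlong cov c V s t V') (hW : HasCovDerivAlong cov c W s t W') :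
    HasDerivWithinAt (fun τ ↦ B (c τ) (V τ) (W τ)) (B (c t) V' (W t) + B (c t) (V t) W') s t := by
  let e := trivializationAt E (TangentSpace I) (c t)
  have hmem : c t ∈ e.baseSet := mem_baseSet_trivializationAt' (c t)
  have hev : ∀ᶠ τ in nhdsWithin t s, c τ ∈ e.baseSet :=
    hc.continuousWithinAt (e.open_baseSet.mem_nhds hmem)
  let β (τ : ℝ) : E →ₗ[ℝ] E →ₗ[ℝ] ℝ := (B (c τ)).compl₁₂ (e.symmₗ ℝ (c τ)) (e.symmₗ ℝ (c τ))
  -- The coefficients of `B` in the coordinate frame are values of `B` on smooth vector fields.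
  have hβ (x y : TangentSpace I (c t)) : HasDerivWithinAt
      (fun τ ↦ β τ (e (⟨c t, x⟩ : TangentBundle I M)).2 (e (⟨c t, y⟩ : TangentBundle I M)).2)
      (B (c t) (cov (extend E x) (c t) (mfderivWithin 𝓘(ℝ, ℝ) I c s t (1 : ℝ))) y
        + B (c t) x (cov (extend E y) (c t) (mfderivWithin 𝓘(ℝ, ℝ) I c s t (1 : ℝ)))) s t := by
    have h := hB.hasDerivWithinAt_comp hc (contMDiffAt_extend (k := ∞) I E x)
      (contMDiffAt_extend (k := ∞) I E y)
    simp only [extend_apply_self] at h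
    refine h.congr_of_eventuallyEq_of_mem ?_ ht
    filter_upwards [hev] with τ hτ
    simp only [β, LinearMap.compl₁₂_apply]
    rw [e.symmₗ_apply hτ, e.symmₗ_apply hτ]
    rfl
  have hcoord (a : E) : (e (⟨c t, e.symm (c t) a⟩ : TangentBundle I M)).2 = a := by
    rw [e.apply_mk_symm hmem]
  have key := hasDerivWithinAt_bilinear_apply (β := β) (hβ (V t) (W t))
    (fun a b ↦ by
      simpa only [hcoord] using (hβ (e.symm (c t) a) (e.symm (c t) b)).differentiableWithinAt) hV hW
  have hsymm (τ : ℝ) (hτ : c τ ∈ e.baseSet) (x : TangentSpace I (c τ)) :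
      e.symmₗ ℝ (c τ) (e (⟨c τ, x⟩ : TangentBundle I M)).2 = x := by
    rw [e.symmₗ_apply hτ, e.symm_apply_apply_mk hτ]
  have key' := key.congr_of_eventuallyEq_of_mem (f₁ := fun τ ↦ B (c τ) (V τ) (W τ)) (by
    filter_upwards [hev] with τ hτ
    simp only [β, LinearMap.compl₁₂_apply]
    rw [hsymm τ hτ, hsymm τ hτ]) ht
  refine key'.congr_deriv ?_
  simp only [β, LinearMap.compl₁₂_apply]
  rw [hsymm t hmem, hsymm t hmem, hsymm t hmem, hsymm t hmem]
  simp only [map_sub, LinearMap.sub_apply]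
  ring

/-- Parallel vector fields along a piecewise `C^1` curve have constant products with respect to a
parallel form. -/
theorem IsParallelForm.apply_eq (hB : IsParallelForm cov B) {n : ℕ} {t : ℕ → ℝ}
    (hc : IsC1Subdivision I c n t) {V W : Π τ, TangentSpace I (c τ)}
    (hV : IsParallelAlong cov c n t V) (hW : IsParallelAlong cov c n t W) :
    B (c 1) (V 1) (W 1) = B (c 0) (V 0) (W 0) := by
  have hstep (i : ℕ) (hi : i < n) :
      B (c (t (i + 1))) (V (t (i + 1))) (W (t (i + 1))) = B (c (t i)) (V (t i)) (W (t i)) := by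
    have hder (τ : ℝ) (hτ : τ ∈ Set.Icc (t i) (t (i + 1))) : HasDerivWithinAt
        (fun τ ↦ B (c τ) (V τ) (W τ)) 0 (Set.Icc (t i) (t (i + 1))) τ := by
      simpa using hB.hasDerivWithinAt
        ((hc.contMDiffOn i hi τ hτ).mdifferentiableWithinAt one_ne_zero) hτ
        (hV i hi τ hτ) (hW i hi τ hτ)
    exact constant_of_derivWithin_zero (fun τ hτ ↦ (hder τ hτ).differentiableWithinAt)
      (fun τ hτ ↦ (hder τ (Set.Ico_subset_Icc_self hτ)).derivWithin
        (uniqueDiffOn_Icc (hc.lt i hi) τ (Set.Ico_subset_Icc_self hτ)))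
      _ (Set.right_mem_Icc.2 (hc.lt i hi).le)
  have hall (k : ℕ) : k ≤ n → B (c (t k)) (V (t k)) (W (t k)) = B (c (t 0)) (V (t 0)) (W (t 0)) := by
    induction k with
    | zero => exact fun _ ↦ rfl
    | succ k ih => exact fun hk ↦ (hstep k hk).trans (ih (by lia))
  have h := hall n le_rfl
  rwa [hc.last, hc.zero] at h

/-- Holonomy transformations preserve parallel forms. -/
theorem IsParallelForm.apply_holonomy (hB : IsParallelForm cov B) {p : M}
    {P : TangentSpace I p →ₗ[ℝ] TangentSpace I p} (hP : P ∈ holonomyGroup cov p)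
    (X Y : TangentSpace I p) : B p (P X) (P Y) = B p X Y := by
  obtain ⟨c, -, -, n, t, hc, h⟩ := hP
  obtain ⟨V, hV, hV₀, hV₁⟩ := h X
  obtain ⟨W, hW, hW₀, hW₁⟩ := h Y
  rw [← form_congr hV₁ hW₁, ← form_congr hV₀ hW₀, hB.apply_eq hc hV hW]

end ParallelForm

section KahlerForms

variable {E : Type*} [NormedAddCommGroup E] [NormedSpace ℝ E] [FiniteDimensional ℝ E]
  [CompleteSpace E] {H : Type*} [TopologicalSpace H] {I : ModelWithCorners ℝ E H}
  {M : Type*} [TopologicalSpace M] [ChartedSpace H M] [IsManifold I ∞ M]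
  [RiemannianBundle (fun x : M ↦ TangentSpace I x)]
  [IsContMDiffRiemannianBundle I ∞ E (fun x : M ↦ TangentSpace I x)]
  {J : Π x : M, TangentSpace I x →L[ℝ] TangentSpace I x}

theorem isParallelForm_inner :
    IsParallelForm (leviCivita I M) (fun x ↦ innerₗ (TangentSpace I x)) := fun x X Y hX hY ↦ by
  have hX' : MDiffAt (T% X) x := hX.mdifferentiableAt (by simp)
  have hY' : MDiffAt (T% Y) x := hY.mdifferentiableAt (by simp)
  refine ⟨mdiffAt_inner hX' hY', fun v ↦ ?_⟩
  simpa using leviCivita_metric (mdifferentiableAt_extend I E v) hX' hY'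

/-- The Hermitian form of a Kähler metric is parallel, since the metric and `J` are. -/
theorem IsKahlerMetric.isParallelForm_hermitianForm (hJ : IsComplexStructure J)
    (hg : IsKahlerMetric J) :
    IsParallelForm (leviCivita I M)
      (fun x ↦ innerₗ (TangentSpace I x) ∘ₗ (J x).toLinearMap) := fun x X Y hX hY ↦ by
  have h := isParallelForm_inner x _ Y (hJ.contMDiffAt_apply hX) hY
  simp only [leviCivita_map hJ hg hX] at h
  exact h

end KahlerForms

/-! ### Unitary frames -/

section UnitaryFrame

/-- A Euclidean vector space of dimension `2m` with an orthogonal complex structure `J` is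
isometric to `ℂ^m`, by an isometry that carries `J` to multiplication by `i`. -/
theorem exists_unitary_equiv {V : Type*} [NormedAddCommGroup V] [InnerProductSpace ℝ V]
    [FiniteDimensional ℝ V] {m : ℕ} (hm : Module.finrank ℝ V = 2 * m) (J : V →ₗ[ℝ] V)
    (hsq : ∀ v, J (J v) = -v) (hJ : ∀ v w : V, inner ℝ (J v) (J w) = inner ℝ v w) :
    ∃ Φ : V ≃ₗ[ℝ] EuclideanSpace ℂ (Fin m),
      (∀ v, Φ (J v) = Complex.I • Φ v) ∧ ∀ v, ‖Φ v‖ = ‖v‖ := by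
  have skew (v w : V) : inner ℝ (J v) w = -inner ℝ v (J w) := by
    rw [← hJ v (J w), hsq, inner_neg_right, neg_neg]
  have inner_J_self (v : V) : inner ℝ (J v) v = 0 := by
    have h := skew v v
    rw [real_inner_comm (J v) v] at h
    linarith
  let ρ : ℂ →ₐ[ℝ] Module.End ℝ V :=
    Complex.lift ⟨J, by ext v; simp [hsq]⟩
  have hρ (z : ℂ) (v : V) : ρ z v = z.re • v + z.im • J v := by
    simp [ρ, Complex.liftAux_apply]
  let _ : Module ℂ V := Module.compHom V (ρ : ℂ →+* Module.End ℝ V)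
  have smul_def (z : ℂ) (v : V) : z • v = z.re • v + z.im • J v := hρ z v
  have : IsScalarTower ℝ ℂ V := ⟨fun r z v ↦ by simp [smul_def, mul_smul]⟩
  -- The Hermitian inner product whose real part is the given one.
  let _ : InnerProductSpace ℂ V :=
    { inner := fun v w ↦ ⟨inner ℝ v w, inner ℝ (J v) w⟩
      norm_smul_le := fun z v ↦ by
        refine le_of_eq ((sq_eq_sq₀ (norm_nonneg _) (by positivity)).1 ?_)
        rw [mul_pow, Complex.sq_norm, Complex.normSq_apply, ← real_inner_self_eq_norm_sq,
          ← real_inner_self_eq_norm_sq, smul_def]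
        simp only [inner_add_left, inner_add_right, real_inner_smul_left, real_inner_smul_right,
          hJ, real_inner_comm (J v) v, inner_J_self]
        ring
      norm_sq_eq_re_inner := fun v ↦ (real_inner_self_eq_norm_sq v).symm
      conj_inner_symm := fun v w ↦ by
        apply Complex.ext
        · exact real_inner_comm v w
        · simp [skew w v, real_inner_comm]
      add_left := fun u v w ↦ by
        apply Complex.ext <;> simp [inner_add_left]
      smul_left := fun v w z ↦ by
        apply Complex.ext <;>
          simp [smul_def, inner_add_left, real_inner_smul_left, hsq] }
  have : FiniteDimensional ℂ V := FiniteDimensional.right ℝ ℂ V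
  have hdim : Module.finrank ℂ V = m := by
    have h := Module.finrank_mul_finrank ℝ ℂ V
    rw [Complex.finrank_real_complex, hm] at h
    lia
  let Ψ : V ≃ₗᵢ[ℂ] EuclideanSpace ℂ (Fin m) :=
    ((stdOrthonormalBasis ℂ V).reindex (finCongr hdim)).repr
  refine ⟨Ψ.toLinearEquiv.restrictScalars ℝ, fun v ↦ ?_, Ψ.norm_map⟩
  have h : J v = Complex.I • v := by simp [smul_def]
  rw [h]
  exact Ψ.map_smul Complex.I v

/-- A linear endomorphism of `ℂ^m` that preserves the norm is given by a unitary matrix. -/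
lemma exists_unitary_matrix {m : ℕ}
    (T : EuclideanSpace ℂ (Fin m) →ₗ[ℂ] EuclideanSpace ℂ (Fin m)) (hT : ∀ z, ‖T z‖ = ‖z‖) :
    ∃ A ∈ Matrix.unitaryGroup (Fin m) ℂ, Matrix.toEuclideanLin A = T := by
  let b := EuclideanSpace.basisFun (Fin m) ℂ
  let U := LinearIsometry.toLinearIsometryEquiv ⟨T, hT⟩ rfl
  refine ⟨_, U.toMatrix_mem_unitaryGroup b b, ?_⟩
  rw [Matrix.toEuclideanLin_eq_toLin_orthonormal]
  exact Matrix.toLin_toMatrix _ _ _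

variable {E : Type*} [NormedAddCommGroup E] [NormedSpace ℝ E]
  {H : Type*} [TopologicalSpace H] {I : ModelWithCorners ℝ E H}
  {M : Type*} [TopologicalSpace M] [ChartedSpace H M]
  [RiemannianBundle (fun x : M ↦ TangentSpace I x)]
  {J : Π x : M, TangentSpace I x →L[ℝ] TangentSpace I x}

/-- Isometries of `T_p M` that commute with `J` are unitary in every unitary frame. -/
lemma IsUnitaryFrame.mem_unitaryGroupIn {m : ℕ} {p : M}
    {Φ : TangentSpace I p ≃ₗ[ℝ] EuclideanSpace ℂ (Fin m)} (hΦ : IsUnitaryFrame J p Φ)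
    {P : TangentSpace I p →ₗ[ℝ] TangentSpace I p} (hP : ∀ v, ‖P v‖ = ‖v‖)
    (hPJ : ∀ v, P (J p v) = J p (P v)) : P ∈ unitaryGroupIn Φ := by
  let T₀ : EuclideanSpace ℂ (Fin m) →ₗ[ℝ] EuclideanSpace ℂ (Fin m) :=
    Φ.toLinearMap ∘ₗ P ∘ₗ Φ.symm.toLinearMap
  have hI (z) : T₀ (Complex.I • z) = Complex.I • T₀ z := by
    have h : Φ.symm (Complex.I • z) = J p (Φ.symm z) := by
      rw [LinearEquiv.symm_apply_eq, hΦ.map_J, LinearEquiv.apply_symm_apply]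
    simp [T₀, h, hPJ, hΦ.map_J]
  let T : EuclideanSpace ℂ (Fin m) →ₗ[ℂ] EuclideanSpace ℂ (Fin m) :=
    { toFun := T₀
      map_add' := T₀.map_add
      map_smul' := fun a z ↦ by
        conv_lhs => rw [← Complex.re_add_im a, add_smul, mul_smul, map_add, Complex.coe_smul,
          Complex.coe_smul, map_smul, map_smul, hI]
        conv_rhs => rw [← Complex.re_add_im a, RingHom.id_apply, add_smul, mul_smul,
          Complex.coe_smul, Complex.coe_smul] }
  have hT (z) : ‖T z‖ = ‖z‖ := by
    change ‖Φ (P (Φ.symm z))‖ = ‖z‖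
    rw [hΦ.norm_map, hP, ← hΦ.norm_map, LinearEquiv.apply_symm_apply]
  obtain ⟨A, hA, hAT⟩ := exists_unitary_matrix T hT
  refine ⟨A, hA, fun v ↦ ?_⟩
  rw [hAT]
  simp [T, T₀]

/-- A linear map that preserves both the metric `g` and the form `ω = g(J·, ·)` commutes with `J`: it
is surjective, and `g(P J v, P w) = g(J v, w) = g(J P v, P w)`. -/
lemma map_complexStructure_of_preserves {p : M} [FiniteDimensional ℝ E]
    {P : TangentSpace I p →ₗ[ℝ] TangentSpace I p}
    (hP : ∀ v w, inner ℝ (P v) (P w) = (inner ℝ v w : ℝ))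
    (hω : ∀ v w, hermitianForm J p (P v) (P w) = hermitianForm J p v w) (v : TangentSpace I p) :
    P (J p v) = J p (P v) := by
  have : FiniteDimensional ℝ (TangentSpace I p) := inferInstanceAs (FiniteDimensional ℝ E)
  have hinj : Function.Injective P := by
    refine (injective_iff_map_eq_zero P).2 fun v hv ↦ ?_
    rw [← inner_self_eq_zero (𝕜 := ℝ), ← hP, hv, inner_zero_left]
  refine ext_inner_right ℝ fun w ↦ ?_
  obtain ⟨w, rfl⟩ := LinearMap.injective_iff_surjective.1 hinj w
  rw [hP]
  exact (hω v w).symm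

end UnitaryFrame

end KahlerHolonomy

theorem mainTheorem4 (m : ℕ) {M : Type*} [TopologicalSpace M]
    [ChartedSpace (EuclideanSpace ℝ (Fin (2 * m))) M] [IsManifold (𝓡 (2 * m)) ∞ M]
    [RiemannianBundle (fun x : M ↦ TangentSpace (𝓡 (2 * m)) x)]
    [IsContMDiffRiemannianBundle (𝓡 (2 * m)) ∞ (EuclideanSpace ℝ (Fin (2 * m)))
      (fun x : M ↦ TangentSpace (𝓡 (2 * m)) x)]
    (J : Π x : M, TangentSpace (𝓡 (2 * m)) x →L[ℝ] TangentSpace (𝓡 (2 * m)) x)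
    (hJ : KahlerHolonomy.IsComplexStructure J)
    (hg : KahlerHolonomy.IsKahlerMetric J) (p : M) :
    ∃ Φ : TangentSpace (𝓡 (2 * m)) p ≃ₗ[ℝ] EuclideanSpace ℂ (Fin m),
      KahlerHolonomy.IsUnitaryFrame J p Φ ∧
      KahlerHolonomy.holonomyGroup (KahlerHolonomy.leviCivita (𝓡 (2 * m)) M) p
        ⊆ KahlerHolonomy.unitaryGroupIn Φ := by
  have : FiniteDimensional ℝ (TangentSpace (𝓡 (2 * m)) p) :=
    inferInstanceAs (FiniteDimensional ℝ (EuclideanSpace ℝ (Fin (2 * m))))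
  have hdim : Module.finrank ℝ (TangentSpace (𝓡 (2 * m)) p) = 2 * m :=
    finrank_euclideanSpace_fin (𝕜 := ℝ)
  obtain ⟨Φ, hΦJ, hΦ⟩ := KahlerHolonomy.exists_unitary_equiv hdim (J p).toLinearMap (hJ.sq p)
    (hg.hermitian p)
  have hframe : KahlerHolonomy.IsUnitaryFrame J p Φ := ⟨hΦJ, hΦ⟩
  refine ⟨Φ, hframe, fun P hP ↦ ?_⟩
  have hinner : ∀ v w, inner ℝ (P v) (P w) = (inner ℝ v w : ℝ) :=
    KahlerHolonomy.isParallelForm_inner.apply_holonomy hP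
  refine hframe.mem_unitaryGroupIn (fun v ↦ ?_)
    (KahlerHolonomy.map_complexStructure_of_preserves hinner
      ((hg.isParallelForm_hermitianForm hJ).apply_holonomy hP))
  rw [norm_eq_sqrt_real_inner, norm_eq_sqrt_real_inner, hinner]
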